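/- Let $K$ be a number field with ring of integers $\mathcal{O}_K$, and let $d=2$ or $d=3$. Let $b,x_0\in K$, where we can write $x_0=s/t$ and $b=u/w$ with $s,t,u,w\in\mathcal{O}_K$, $t,w\neq 0$, such that the ideals $(s,t)$ and $(u,w)$ both equal $\mathcal{O}_K$. Let $f(x)=x^d-bx$, write $f^n$ for the $n$-th iterate of $f$ (with $f^0(x)=x$), $\Delta(g)$ for the discriminant of a polynomial $g$, $v_{\mathfrak p}$ for the normalized additive valuation at a prime $\mathfrak p$ of $\mathcal{O}_K$ (a nonzero prime ideal), with $v_{\mathfrak p}(0)=\infty$, and $f^{-n}(x_0)=\{\alpha\in\overline{K} : f^n(\alpha)=x_0\}$. Suppose that 1. there is a prime $\mathfrak p_1$ of $\mathcal{O}_K$ with $v_{\mathfrak p_1}(b)\geq 1$ and $v_{\mathfrak p_1}(x_0)=1$; and 2. for each $n\geq 1$, there is a prime $\mathfrak p$ of $\mathcal{O}_K$ with $\mathfrak p\nmid stuwd(d-1)$ such that $v_{\mathfrak p}(\Delta(f^n(x)-x_0))$ is a positive odd integer, and such that $v_{\mathfrak p}(\Delta(f^{\ell}(x)-x_0))=0$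 for all $0\leq \ell<n$. Then for all $n\geq 0$, $$\mathrm{Gal}\big(K(f^{-n}(x_0))/K\big)\cong [S_d]^n,$$ where $[S_d]^n$ is the $n$-fold iterated wreath product of the symmetric group $S_d$, acting on $d$ letters, with itself: $[S_d]^0$ is trivial and $[S_d]^{n+1}=[S_d]^n\wr S_d=([S_d]^n)^d\rtimes S_d$, with $S_d$ permuting the coordinates; equivalently, $[S_d]^n$ is the automorphism group of the $d$-ary rooted tree with $n$ levels. -/

import Mathlib

open Polynomial IsDedekindDomain NumberField

/-- The (permutational) wreath product `G ≀ Sym(Ω)`, i.e. the semidirect product `G^Ω ⋊ Sym(Ω)` in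
which `Sym(Ω)` permutes the coordinates of `G^Ω`. -/
abbrev PermWreath (G Ω : Type) [Group G] : Type :=
  (Ω → G) ⋊[(mulAutArrow : Equiv.Perm Ω →* MulAut (Ω → G))] Equiv.Perm Ω

/-- The underlying group of `[S_d]^n`, bundled with its group structure. -/
def iterSymBundled (d : ℕ) : ℕ → (G : Type) × Group G
  | 0 => ⟨Unit, inferInstance⟩
  | n + 1 =>
    letI : Group (iterSymBundled d n).1 := (iterSymBundled d n).2
    ⟨PermWreath (iterSymBundled d n).1 (Fin d), inferInstance⟩

/-- `[S_d]^n`, the `n`-fold iterated wreath product of the symmetric group `S_d` (acting on `d`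
letters) with itself: `[S_d]^0` is trivial and `[S_d]^(n+1) = [S_d]^n ≀ S_d`. Equivalently, this is
the automorphism group of the `d`-ary rooted tree with `n` levels: `S_d` permutes the `d` subtrees
below the root, and each coordinate of `([S_d]^n)^d` acts on one of them. -/
def IterSym (d n : ℕ) : Type := (iterSymBundled d n).1

instance instGroupIterSym (d n : ℕ) : Group (IterSym d n) := (iterSymBundled d n).2

/-- The set `f^{-n}(x₀)` of `n`-th preimages of `x₀` in the algebraic closure of `K`. -/
def iterPreimage {K : Type*} [Field K] (f : K[X]) (x₀ : K) (n : ℕ) : Set (AlgebraicClosure K) :=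
  {α | (fun y => aeval y f)^[n] α = algebraMap K (AlgebraicClosure K) x₀}

/-- The field `K(f^{-n}(x₀))`. -/
noncomputable abbrev preimageField {K : Type*} [Field K] (f : K[X]) (x₀ : K) (n : ℕ) :
    IntermediateField K (AlgebraicClosure K) :=
  IntermediateField.adjoin K (iterPreimage f x₀ n)

/-- The polynomial `f^n(x) - x₀`, where `f^n` is the `n`-th iterate of `f` (and `f^0 = x`). -/
noncomputable def iterSubC {K : Type*} [Field K] (f : K[X]) (x₀ : K) (n : ℕ) : K[X] :=
  f.comp^[n] X - C x₀

/-- `HasOrd 𝔭 x k` says that `x ≠ 0` and that the normalized additive valuation `v_𝔭(x)` is `k`.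
(Mathlib's valuation is multiplicative: it sends `x` to `exp (-v_𝔭(x))`, and `0` to `0`.) -/
def HasOrd {K : Type*} [Field K] [NumberField K] (𝔭 : HeightOneSpectrum (𝓞 K)) (x : K) (k : ℤ) :
    Prop :=
  𝔭.valuation K x = WithZero.exp (-k)

/-!
The Galois group acts on the leaves of the tree of iterated preimages of `x₀`, so it embeds in the
automorphism group `[S_d]^n` of that tree; the point is that it is everything.

Condition (1) makes `f^n(x) - x₀` an Eisenstein polynomial at `𝔭₁`, hence the action is transitive
on each level. At a prime `𝔭` where `Δ(f^(m+1)(x) - x₀)` has odd valuation the square root of the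
discriminant generates a ramified extension, so some element `σ` of an inertia group above `𝔭` acts
on level `m + 1` as an odd permutation. It fixes level `m`, whose points stay distinct modulo `𝔭`,
and a point it moves is a multiple root of its fibre modulo `𝔭`, i.e. reduces to a critical point of
`f`. Now `f` has one critical point if `d = 2`, and if `d = 3` its two critical values are opposite,
so that, `f` being odd, they cannot both be roots of `f^m(x) - x₀` modulo `𝔭`, as `2x₀ ≢ 0`. Hence
the points moved by `σ` lie in a single fibre, of size `d ≤ 3`, and `σ` acts as a transposition.

Finally, the conjugates of a transposition inside a fibre of prime size `d` under a group that is
transitive on the level generate the full kernel of the map from level `m + 1` to level `m`, and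
induction on `m` finishes the proof.
-/

section Descent

variable {α β : Type*}

theorem exists_perm_semiconj {q : α → β} (hq : q.Surjective) (π : Equiv.Perm α)
    (hπ : ∀ a b, q (π a) = q (π b) ↔ q a = q b) :
    ∃ σ : Equiv.Perm β, Function.Semiconj q π σ := by
  let e := Setoid.quotientKerEquivOfSurjective q hq
  have he (a : α) : e.symm (q a) = Quotient.mk (Setoid.ker q) a := e.symm_apply_apply ⟦a⟧
  refine ⟨e.symm.trans ((Quotient.congr π fun a b => (hπ a b).symm).trans e), fun a => ?_⟩
  simp only [Equiv.trans_apply, he]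
  rfl

theorem exists_perm_prod_eq (π : Equiv.Perm (α × β)) (hπ : ∀ a b, (π a).1 = (π b).1 ↔ a.1 = b.1) :
    ∃ (σ : Equiv.Perm α) (τ : α → Equiv.Perm β), ∀ i x, π (i, x) = (σ i, τ i x) := by
  obtain _ | _ := isEmpty_or_nonempty β
  · exact ⟨1, 1, fun i x => isEmptyElim x⟩
  obtain ⟨σ, hσ⟩ := exists_perm_semiconj Prod.fst_surjective π hπ
  have hτ (i : α) : Function.Bijective fun x => (π (i, x)).2 := by
    refine ⟨fun x y hxy => ?_, fun y => ?_⟩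
    · have := π.injective (Prod.ext ((hπ (i, x) (i, y)).2 rfl) hxy)
      exact (Prod.mk.inj this).2
    · obtain ⟨⟨k, x⟩, hkx⟩ := π.surjective (σ i, y)
      obtain rfl : k = i := σ.injective (by rw [← hσ (k, x), hkx])
      exact ⟨x, congrArg Prod.snd hkx⟩
  exact ⟨σ, fun i => Equiv.ofBijective _ (hτ i), fun i x => Prod.ext (hσ (i, x)) rfl⟩

end Descent

/-- The leaves of the `d`-ary rooted tree with `n` levels, as words read from the root. -/
abbrev TreeWord (d : ℕ) : ℕ → Type
  | 0 => Unit
  | n + 1 => Fin d × TreeWord d n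

namespace TreeWord

variable {d : ℕ}

/-- The ancestors of two leaves `j` levels up coincide. Since `j` counts from the leaves, this is
no condition once `n ≤ j`. -/
def AncestorEq (j : ℕ) : (n : ℕ) → TreeWord d n → TreeWord d n → Prop
  | 0, _, _ => True
  | n + 1, v, w => j ≤ n → v.1 = w.1 ∧ AncestorEq j n v.2 w.2

theorem ancestorEq_of_le {j : ℕ} : ∀ {n : ℕ}, n ≤ j → ∀ v w : TreeWord d n, AncestorEq j n v w
  | 0, _, _, _ => trivial
  | _ + 1, hn, _, _ => fun hj => absurd hn (not_le.2 (Nat.lt_succ_of_le hj))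

instance instNonempty [NeZero d] : ∀ n, Nonempty (TreeWord d n)
  | 0 => ⟨()⟩
  | n + 1 =>
    have : Nonempty (TreeWord d n) := instNonempty n
    inferInstanceAs (Nonempty (Fin d × TreeWord d n))

instance instFinite : ∀ n, Finite (TreeWord d n)
  | 0 => inferInstanceAs (Finite Unit)
  | n + 1 =>
    have : Finite (TreeWord d n) := instFinite n
    inferInstanceAs (Finite (Fin d × TreeWord d n))

end TreeWord

namespace PermWreath

variable {G Ω X : Type} [Group G]

/-- The imprimitive action of a wreath product on `Ω × X`, for a group `G` acting on `X`. -/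
def toPermProd (ρ : G →* Equiv.Perm X) : PermWreath G Ω →* Equiv.Perm (Ω × X) where
  toFun a :=
    { toFun p := (a.right p.1, ρ (a.left (a.right p.1)) p.2)
      invFun p := (a.right⁻¹ p.1, (ρ (a.left p.1))⁻¹ p.2)
      left_inv p := by simp
      right_inv p := by simp }
  map_one' := by ext p <;> simp
  map_mul' a b := by
    refine Equiv.ext fun p => Prod.ext (by simp) ?_
    have h : (mulAutArrow a.right b.left : Ω → G) (a.right (b.right p.1)) =
        b.left (b.right p.1) := congrArg b.left (a.right.symm_apply_apply _)
    simp only [Equiv.coe_fn_mk, SemidirectProduct.mul_left, SemidirectProduct.mul_right,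
      Pi.mul_apply, map_mul, Equiv.Perm.mul_apply, h]

@[simp]
theorem toPermProd_apply (ρ : G →* Equiv.Perm X) (a : PermWreath G Ω) (p : Ω × X) :
    toPermProd ρ a p = (a.right p.1, ρ (a.left (a.right p.1)) p.2) := rfl

theorem toPermProd_injective [Nonempty X] {ρ : G →* Equiv.Perm X} (hρ : Function.Injective ρ) :
    Function.Injective (toPermProd (Ω := Ω) ρ) := by
  intro a b hab
  have key (i : Ω) (x : X) := Prod.ext_iff.1 (DFunLike.congr_fun hab (i, x))
  simp only [toPermProd_apply] at key
  have hr : a.right = b.right := Equiv.ext fun i => (key i (Classical.arbitrary X)).1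
  refine SemidirectProduct.ext (funext fun j => hρ (Equiv.ext fun x => ?_)) hr
  simpa [← hr] using (key (a.right⁻¹ j) x).2

theorem mem_range_toPermProd_iff {ρ : G →* Equiv.Perm X} {π : Equiv.Perm (Ω × X)} :
    π ∈ (toPermProd ρ).range ↔
      ∃ (σ : Equiv.Perm Ω) (g : Ω → G), ∀ i x, π (i, x) = (σ i, ρ (g i) x) := by
  constructor
  · rintro ⟨a, rfl⟩
    exact ⟨a.right, fun i => a.left (a.right i), fun _ _ => rfl⟩
  · rintro ⟨σ, g, h⟩
    exact ⟨⟨fun i => g (σ⁻¹ i), σ⟩, Equiv.ext fun p => by simp [h]⟩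

end PermWreath

namespace IterSym

open TreeWord

/-- The action of `[S_d]^n` on the leaves of the `d`-ary rooted tree with `n` levels. -/
def toPerm (d : ℕ) : (n : ℕ) → IterSym d n →* Equiv.Perm (TreeWord d n)
  | 0 => 1
  | n + 1 => PermWreath.toPermProd (G := IterSym d n) (Ω := Fin d) (toPerm d n)

theorem toPerm_injective (d : ℕ) [NeZero d] : ∀ n, Function.Injective (toPerm d n)
  | 0 => fun (_ : Unit) (_ : Unit) _ => rfl
  | n + 1 => PermWreath.toPermProd_injective (G := IterSym d n) (Ω := Fin d) (toPerm_injective d n)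

theorem mem_range_toPerm_iff {d : ℕ} : ∀ {n : ℕ} {π : Equiv.Perm (TreeWord d n)},
    π ∈ (toPerm d n).range ↔ ∀ j v w, AncestorEq j n (π v) (π w) ↔ AncestorEq j n v w
  | 0, π => by
    refine iff_of_true ⟨1, Equiv.ext fun (v : Unit) => ?_⟩ fun _ _ _ => Iff.rfl
    exact (rfl : ((toPerm d 0 1) v : Unit) = π v)
  | n + 1, π => by
    refine (PermWreath.mem_range_toPermProd_iff (G := IterSym d n) (Ω := Fin d)
      (ρ := toPerm d n) (π := π)).trans ⟨?_, fun h => ?_⟩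
    · rintro ⟨σ, g, h⟩ j ⟨i, v⟩ ⟨k, w⟩
      rw [h, h]
      refine forall_congr' fun _ => ?_
      simp only [σ.apply_eq_iff_eq]
      refine and_congr_right fun hik => ?_
      subst hik
      exact mem_range_toPerm_iff.1 ⟨g i, rfl⟩ j v w
    · have hfst (v w : TreeWord d (n + 1)) : (π v).1 = (π w).1 ↔ v.1 = w.1 := by
        simpa [AncestorEq, ancestorEq_of_le] using h n v w
      obtain ⟨σ, τ, hτ⟩ := exists_perm_prod_eq (α := Fin d) (β := TreeWord d n) π hfst
      have hmem (i : Fin d) : τ i ∈ (toPerm d n).range := mem_range_toPerm_iff.2 fun j v w => by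
        by_cases hj : j ≤ n
        · have hπ := h j (i, v) (i, w)
          rw [hτ, hτ] at hπ
          simpa [AncestorEq, hj] using hπ
        · exact iff_of_true (ancestorEq_of_le (not_le.1 hj).le _ _)
            (ancestorEq_of_le (not_le.1 hj).le _ _)
      choose g hg using hmem
      exact ⟨σ, g, fun i x => by rw [hτ, hg]⟩

end IterSym

section PreimageTree

open TreeWord

variable {Ω : Type*} {f : Ω → Ω} {x : Ω} {d n : ℕ}

theorem iterate_eq_iterate_of_le {i j : ℕ} (hij : i ≤ j) {y z : Ω} (h : f^[i] y = f^[i] z) :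
    f^[j] y = f^[j] z := by
  obtain ⟨k, rfl⟩ := Nat.exists_eq_add_of_le' hij
  rw [Function.iterate_add_apply, h, Function.iterate_add_apply]

/-- The automorphism group of the tree of iterated preimages of `x` up to level `n`, as a group of
permutations of its leaves. -/
def preimageTreeAut (f : Ω → Ω) (x : Ω) (n : ℕ) : Subgroup (Equiv.Perm {y // f^[n] y = x}) where
  carrier := {π | ∀ (j : ℕ) (y z : {y // f^[n] y = x}), f^[j] (π y) = f^[j] (π z) ↔
    f^[j] y = f^[j] (z : Ω)}
  one_mem' _ _ _ := Iff.rfl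
  mul_mem' hπ hσ j y z := (hπ j _ _).trans (hσ j y z)
  inv_mem' {π} hπ j y z := by simpa using (hπ j (π⁻¹ y) (π⁻¹ z)).symm

theorem exists_treeWord_equiv [NeZero d] : ∀ {n : ℕ} {x : Ω},
    (∀ k < n, ∀ y, f^[k] y = x → Nat.card {z // f z = y} = d) →
    ∃ e : TreeWord d n ≃ {y // f^[n] y = x}, ∀ j v w,
      AncestorEq j n v w ↔ f^[j] (e v : Ω) = f^[j] (e w)
  | 0, x, _ => by
    let e : TreeWord d 0 ≃ {y // f^[0] y = x} :=
      ⟨fun _ => ⟨x, rfl⟩, fun _ => (), fun _ => rfl, fun y => Subtype.ext y.2.symm⟩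
    exact ⟨e, fun _ _ _ => iff_of_true trivial rfl⟩
  | n + 1, x, hcard => by
    have hx : Nat.card {z // f z = x} = d := hcard 0 n.succ_pos x rfl
    have : Finite {z // f z = x} := Nat.finite_of_card_ne_zero (hx.trans_ne (NeZero.ne d))
    let c : Fin d ≃ {z // f z = x} := (Finite.equivFinOfCardEq hx).symm
    have ih (i : Fin d) := exists_treeWord_equiv (x := (c i : Ω)) fun k hk y hy =>
      hcard (k + 1) (Nat.succ_lt_succ hk) y (by rw [Function.iterate_succ_apply', hy, (c i).2])
    choose e he using ih
    let E : TreeWord d (n + 1) ≃ {y // f^[n + 1] y = x} :=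
      (Equiv.sigmaEquivProd (Fin d) (TreeWord d n)).symm.trans <| (Equiv.sigmaCongr c e).trans <|
        Equiv.sigmaSubtypeFiberEquivSubtype f^[n] fun y => by rw [Function.iterate_succ_apply']
    have hE (v : TreeWord d (n + 1)) : (E v : Ω) = e v.1 v.2 := rfl
    refine ⟨E, fun j v w => ?_⟩
    by_cases hj : j ≤ n
    · have hfst (h : f^[j] (E v : Ω) = f^[j] (E w)) : v.1 = w.1 := c.injective <| Subtype.ext <| by
        simpa only [hE, (e _ _).2] using iterate_eq_iterate_of_le hj h
      obtain ⟨i, v⟩ := v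
      obtain ⟨k, w⟩ := w
      simp only [AncestorEq, hj, true_imp_iff]
      refine ⟨?_, fun h => ⟨hfst h, ?_⟩⟩
      · rintro ⟨rfl, hvw⟩
        exact (he i j v w).1 hvw
      · obtain rfl : i = k := hfst h
        exact (he i j v w).2 h
    · exact iff_of_true (ancestorEq_of_le (not_le.1 hj) v w)
        (iterate_eq_iterate_of_le (not_le.1 hj) ((E v).2.trans (E w).2.symm))

theorem nonempty_preimageTreeAut_mulEquiv_iterSym [NeZero d]
    (hcard : ∀ k < n, ∀ y, f^[k] y = x → Nat.card {z // f z = y} = d) :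
    Nonempty (preimageTreeAut f x n ≃* IterSym d n) := by
  obtain ⟨e, he⟩ := exists_treeWord_equiv hcard
  let χ : IterSym d n →* Equiv.Perm {y // f^[n] y = x} :=
    e.permCongrHom.toMonoidHom.comp (IterSym.toPerm d n)
  have hχ : Function.Injective χ := e.permCongrHom.injective.comp (IterSym.toPerm_injective d n)
  have hrange : χ.range = preimageTreeAut f x n := by
    ext π
    rw [MonoidHom.range_comp, Subgroup.mem_map_equiv, IterSym.mem_range_toPerm_iff]
    have hπ (y) : e (e.permCongrHom.symm π (e.symm y)) = π y := by simp [Equiv.permCongrHom]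
    simp only [he, e.forall_congr_left, hπ, e.apply_symm_apply]
    exact Iff.rfl
  exact ⟨((MonoidHom.ofInjective hχ).trans (MulEquiv.subgroupCongr hrange)).symm⟩

/-- The map from the leaves of the tree of iterated preimages of `x` up to level `n + 1` to those of
the tree up to level `n`. -/
def preimageParent (f : Ω → Ω) (x : Ω) (n : ℕ) :
    {y // f^[n + 1] y = x} → {y // f^[n] y = x} := Subtype.map f fun _ => id

theorem preimageParent_eq_iff {y z : {y // f^[n + 1] y = x}} :
    preimageParent f x n y = preimageParent f x n z ↔ f y = f z := Subtype.ext_iff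

theorem natCard_preimageParent_fiber (y : {y // f^[n] y = x}) :
    Nat.card {z // preimageParent f x n z = y} = Nat.card {z // f z = y} := by
  have hmem {z : Ω} (hz : f z = y) : f^[n + 1] z = x := by
    rw [Function.iterate_succ_apply, hz, y.2]
  exact Nat.card_congr <| (Equiv.subtypeEquivRight fun z => Subtype.ext_iff).trans <|
    Equiv.subtypeSubtypeEquivSubtype (p := (f^[n + 1] · = x)) (q := (f · = y)) hmem

theorem preimageParent_apply_eq_iff {π : Equiv.Perm {y // f^[n + 1] y = x}}
    (hπ : π ∈ preimageTreeAut f x (n + 1)) (y z : {y // f^[n + 1] y = x}) :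
    preimageParent f x n (π y) = preimageParent f x n (π z) ↔
      preimageParent f x n y = preimageParent f x n z := by
  simpa only [preimageParent_eq_iff, Function.iterate_one] using hπ 1 y z

theorem exists_mem_preimageTreeAut_semiconj (hsurj : Function.Surjective (preimageParent f x n))
    {π : Equiv.Perm {y // f^[n + 1] y = x}} (hπ : π ∈ preimageTreeAut f x (n + 1)) :
    ∃ σ ∈ preimageTreeAut f x n, Function.Semiconj (preimageParent f x n) π σ := by
  obtain ⟨σ, hσ⟩ := exists_perm_semiconj hsurj π (preimageParent_apply_eq_iff hπ)
  refine ⟨σ, fun j => hsurj.forall₂.2 fun y z => ?_, hσ⟩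
  rw [← hσ.eq, ← hσ.eq]
  exact hπ (j + 1) y z

end PreimageTree

section FiberSwaps

variable {α β : Type*} {q : α → β} {H : Subgroup (Equiv.Perm α)}

theorem mem_of_forall_swap_mem [Finite α] [DecidableEq α] {π : Equiv.Perm α}
    (hπ : ∀ a, Equiv.swap a (π a) ∈ H) : π ∈ H := by
  have hle : Subgroup.closure {σ ∈ H | σ.IsSwap} ≤ H := (Subgroup.closure_le _).2 fun _ h => h.1
  refine hle ((mem_closure_isSwap fun _ h => h.2).2 ⟨Set.toFinite _, fun a => ?_⟩)
  obtain ha | ha := eq_or_ne a (π a)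
  · rw [← ha]
    exact MulAction.mem_orbit_self a
  · exact ⟨⟨_, Subgroup.subset_closure ⟨hπ a, a, _, ha, rfl⟩⟩, Equiv.swap_apply_left a (π a)⟩

theorem dvd_natCard_of_forall_natCard_class [Finite α] (s : Setoid α) {m : ℕ}
    (hs : ∀ a, Nat.card {b // s b a} = m) : m ∣ Nat.card α := by
  have := Fintype.ofFinite (Quotient s)
  rw [Nat.card_congr (Equiv.sigmaFiberEquiv (Quotient.mk s)).symm, Nat.card_sigma]
  refine Finset.dvd_sum fun c _ => ?_
  induction c using Quotient.inductionOn with | h a =>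
  simp only [Quotient.eq, hs, dvd_refl]

variable [DecidableEq α]

/-- The equivalence relation of lying in the same fibre of `q` and being swapped by a transposition
in `H` (or being equal). -/
def fiberSwapSetoid (q : α → β) (H : Subgroup (Equiv.Perm α)) : Setoid α where
  r a b := q a = q b ∧ Equiv.swap a b ∈ H
  iseqv :=
    { refl a := ⟨rfl, by rw [Equiv.swap_self]; exact H.one_mem⟩
      symm h := ⟨h.1.symm, by rw [Equiv.swap_comm]; exact h.2⟩
      trans h h' := ⟨h.1.trans h'.1, SubmonoidClass.swap_mem_trans H h.2 h'.2⟩ }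

theorem fiberSwapSetoid_apply_iff {h : Equiv.Perm α} (hh : h ∈ H)
    (hq : ∀ a b, q (h a) = q (h b) ↔ q a = q b) {a b : α} :
    fiberSwapSetoid q H (h a) (h b) ↔ fiberSwapSetoid q H a b := by
  refine and_congr (hq a b) ?_
  rw [Equiv.swap_apply_apply, H.mul_mem_cancel_right (H.inv_mem hh), H.mul_mem_cancel_left hh]

-- The classes of `fiberSwapSetoid q H` all have the same size `m`. It divides the size `p` of the
-- fibres of `q` and is not `1`, so every fibre is a single class.
theorem swap_mem_of_prime_natCard_fiber [Finite α] {p : ℕ} (hp : p.Prime)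
    (hq : ∀ h ∈ H, ∀ a b, q (h a) = q (h b) ↔ q a = q b) (htrans : ∀ a b, ∃ h ∈ H, h a = b)
    (hcard : ∀ a, Nat.card {b // q b = q a} = p) {a₀ b₀ : α} (hne : a₀ ≠ b₀) (hq₀ : q a₀ = q b₀)
    (hswap : Equiv.swap a₀ b₀ ∈ H) {a b : α} (hab : q a = q b) : Equiv.swap a b ∈ H := by
  let s := fiberSwapSetoid q H
  have hconst (c : α) : Nat.card {b // s b c} = Nat.card {b // s b a₀} := by
    obtain ⟨h, hh, rfl⟩ := htrans a₀ c
    refine (Nat.card_congr (h.subtypeEquiv fun b => ?_)).symm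
    exact (fiberSwapSetoid_apply_iff hh (hq h hh)).symm
  have hdvd : Nat.card {b // s b a₀} ∣ p := by
    rw [← hcard a₀]
    refine dvd_natCard_of_forall_natCard_class (s.comap Subtype.val) fun c => ?_
    rw [← hconst c]
    exact Nat.card_congr (Equiv.subtypeSubtypeEquivSubtype (p := (q · = q a₀)) (q := (s · c))
      fun hb => hb.1.trans c.2)
  have hne_one : Nat.card {b // s b a₀} ≠ 1 := fun h => by
    have := (Nat.card_eq_one_iff_unique.1 h).1
    have hb₀ : s b₀ a₀ := s.symm ⟨hq₀, hswap⟩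
    exact hne (congrArg Subtype.val (this.elim ⟨a₀, s.refl a₀⟩ ⟨b₀, hb₀⟩))
  have hm : Nat.card {c // s c b} = Nat.card {c // q c = q b} := by
    rw [hconst, hcard, ((Nat.dvd_prime hp).1 hdvd).resolve_left hne_one]
  have hinj : Function.Injective (Subtype.impEmbedding (s · b) (q · = q b) fun _ h => h.1) :=
    Function.Embedding.injective _
  obtain ⟨⟨c, hc⟩, hca⟩ := ((Nat.bijective_iff_injective_and_card _).2 ⟨hinj, hm⟩).2 ⟨a, hab⟩
  obtain rfl : c = a := congrArg Subtype.val hca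
  exact hc.2

theorem mem_of_prime_natCard_fiber [Finite α] {p : ℕ} (hp : p.Prime)
    (hq : ∀ h ∈ H, ∀ a b, q (h a) = q (h b) ↔ q a = q b) (htrans : ∀ a b, ∃ h ∈ H, h a = b)
    (hcard : ∀ a, Nat.card {b // q b = q a} = p) {a₀ b₀ : α} (hne : a₀ ≠ b₀) (hq₀ : q a₀ = q b₀)
    (hswap : Equiv.swap a₀ b₀ ∈ H) {π : Equiv.Perm α} (hπ : ∀ a, q (π a) = q a) : π ∈ H :=
  mem_of_forall_swap_mem fun a =>
    swap_mem_of_prime_natCard_fiber hp hq htrans hcard hne hq₀ hswap (hπ a).symm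

end FiberSwaps

section PreimageAction

variable {G Ω : Type*} [Group G] [MulAction G Ω] {f : Ω → Ω}

/-- The permutation representation of `G` on the `n`-th preimages of a fixed point of `G` under an
equivariant map. -/
def preimagePermHom (hf : ∀ g : G, Function.Commute (g • ·) f) {x : Ω} (hx : ∀ g : G, g • x = x)
    (n : ℕ) : G →* Equiv.Perm {y // f^[n] y = x} :=
  have hmem (g : G) (y : {y // f^[n] y = x}) : f^[n] (g • (y : Ω)) = x :=
    ((hf g).iterate_right n y).symm.trans ((congrArg (g • ·) y.2).trans (hx g))
  { toFun g :=
      { toFun y := ⟨g • (y : Ω), hmem g y⟩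
        invFun y := ⟨g⁻¹ • (y : Ω), hmem g⁻¹ y⟩
        left_inv y := by simp
        right_inv y := by simp }
    map_one' := by ext; simp
    map_mul' g h := by ext; simp [mul_smul] }

variable (hf : ∀ g : G, Function.Commute (g • ·) f) {x : Ω} (hx : ∀ g : G, g • x = x)

@[simp]
theorem coe_preimagePermHom_apply (n : ℕ) (g : G) (y : {y // f^[n] y = x}) :
    (preimagePermHom hf hx n g y : Ω) = g • (y : Ω) := rfl

theorem preimagePermHom_mem_preimageTreeAut (n : ℕ) (g : G) :
    preimagePermHom hf hx n g ∈ preimageTreeAut f x n := by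
  intro j y z
  have h (y : Ω) : f^[j] (g • y) = g • f^[j] y := ((hf g).iterate_right j y).symm
  simp only [coe_preimagePermHom_apply, h, smul_left_cancel_iff]

theorem preimageParent_preimagePermHom (n : ℕ) (g : G) :
    Function.Semiconj (preimageParent f x n) (preimagePermHom hf hx (n + 1) g)
      (preimagePermHom hf hx n g) := fun y => Subtype.ext ((hf g).eq y).symm

theorem range_preimagePermHom_eq [DecidableEq Ω] {p n : ℕ} (hp : p.Prime)
    (hcard : ∀ k < n, ∀ y, f^[k] y = x → Nat.card {z // f z = y} = p)
    (htrans : ∀ k ≤ n, ∀ y z : {y // f^[k] y = x}, ∃ g : G, g • (y : Ω) = z)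
    (hswap : ∀ k < n, ∃ a b : {y // f^[k + 1] y = x}, a ≠ b ∧ f a = f b ∧
      Equiv.swap a b ∈ (preimagePermHom hf hx (k + 1)).range) :
    (preimagePermHom hf hx n).range = preimageTreeAut f x n := by
  induction n with
  | zero =>
    have : Subsingleton {y // f^[0] y = x} := ⟨fun y z => Subtype.ext (y.2.trans z.2.symm)⟩
    exact Subsingleton.elim _ _
  | succ n ih =>
    refine le_antisymm ?_ fun π hπ => ?_
    · rintro _ ⟨g, rfl⟩
      exact preimagePermHom_mem_preimageTreeAut hf hx (n + 1) g
    have : NeZero p := ⟨hp.ne_zero⟩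
    obtain ⟨e, -⟩ := exists_treeWord_equiv hcard
    have := Finite.of_equiv _ e
    have hcard' (y : {y // f^[n] y = x}) : Nat.card {z // preimageParent f x n z = y} = p :=
      (natCard_preimageParent_fiber y).trans (hcard n n.lt_succ_self y y.2)
    have hsurj : Function.Surjective (preimageParent f x n) := fun y => by
      have := (Nat.card_pos_iff.1 ((hcard' y).symm ▸ hp.pos)).1
      exact ⟨this.some, this.some.2⟩
    obtain ⟨σ, hσ, hπσ⟩ := exists_mem_preimageTreeAut_semiconj hsurj hπ
    obtain ⟨g, rfl⟩ := (ih (fun k hk => hcard k (hk.trans n.lt_succ_self))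
      (fun k hk => htrans k (hk.trans n.le_succ))
      (fun k hk => hswap k (hk.trans n.lt_succ_self))).ge hσ
    obtain ⟨a₀, b₀, hne, hab, hswap⟩ := hswap n n.lt_succ_self
    have hg : (preimagePermHom hf hx (n + 1) g)⁻¹ ∈ (preimagePermHom hf hx (n + 1)).range :=
      inv_mem ⟨g, rfl⟩
    rw [← Subgroup.mul_mem_cancel_left _ hg]
    refine mem_of_prime_natCard_fiber hp ?_ ?_ (hcard' <| preimageParent f x n ·) hne
      (preimageParent_eq_iff.2 hab) hswap fun y => ?_
    · rintro _ ⟨h, rfl⟩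
      exact preimageParent_apply_eq_iff (preimagePermHom_mem_preimageTreeAut hf hx (n + 1) h)
    · intro y z
      obtain ⟨h, hyz⟩ := htrans (n + 1) le_rfl y z
      exact ⟨_, ⟨h, rfl⟩, Subtype.ext hyz⟩
    · rw [Equiv.Perm.mul_apply, ← map_inv, (preimageParent_preimagePermHom hf hx n g⁻¹).eq,
        hπσ.eq, map_inv]
      exact (preimagePermHom hf hx n g).symm_apply_apply _

end PreimageAction

section Discriminant

theorem prod_prod_compl_sub_eq_det_vandermonde_sq {R : Type*} [CommRing R] {n : ℕ} (r : Fin n → R) :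
    ∏ i, ∏ j ∈ {i}ᶜ, (r i - r j) =
      (-1) ^ (n * (n - 1) / 2) * (Matrix.vandermonde r).det ^ 2 := by
  have hsign : ∏ i : Fin n, ∏ j ∈ Finset.Ioi i, (-1 : R) = (-1) ^ (n * (n - 1) / 2) := by
    simp only [Finset.prod_const, Fin.card_Ioi, Finset.prod_pow_eq_pow_sum]
    rw [Fin.sum_univ_eq_sum_range (n - 1 - ·) n, Finset.sum_range_reflect (·) n,
      Finset.sum_range_id]
  have h := Finset.prod_prod_Ioi_mul_eq_prod_prod_off_diag fun j i => r i - r j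
  rw [← h, Matrix.det_vandermonde, ← hsign]
  simp only [← Finset.prod_pow, ← Finset.prod_mul_distrib]
  exact Finset.prod_congr rfl fun i _ => Finset.prod_congr rfl fun j _ => by ring

theorem map_discr_eq_det_vandermonde_sq {R M : Type*} [CommRing R] [CommRing M] [Nontrivial M]
    (φ : R →+* M) {g : R[X]} (hg : g.Monic) {n : ℕ} {r : Fin n → M}
    (hr : g.map φ = ∏ i, (X - C (r i))) : φ g.discr = (Matrix.vandermonde r).det ^ 2 := by
  have : Nontrivial R := φ.domain_nontrivial
  have hdeg : g.natDegree = n := by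
    rw [← hg.natDegree_map φ, hr, natDegree_finsetProd_X_sub_C_eq_card, Finset.card_fin]
  obtain rfl | hn := Nat.eq_zero_or_pos n
  · rw [hg.natDegree_eq_zero.1 hdeg, ← C_1, discr_C]
    simp
  have hder_deg := natDegree_map_le (f := φ).trans (natDegree_derivative_le g)
  have hder (i : Fin n) :
      ((derivative g).map φ).eval (r i) = ∏ j ∈ {i}ᶜ, (r i - r j) := by
    rw [← derivative_map, hr, ← Lagrange.nodal,
      Lagrange.eval_nodal_derivative_eval_node_eq (Finset.mem_univ i),
      Lagrange.eval_nodal, Finset.compl_singleton]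
  have hres := resultant_prod_left Finset.univ (fun i => X - C (r i)) _ _ (by simp) hder_deg
  simp only [natDegree_X_sub_C, resultant_X_sub_C_left _ _ _ hder_deg] at hres
  simp only [hder, prod_prod_compl_sub_eq_det_vandermonde_sq] at hres
  rw [← hr, hg.natDegree_map, resultant_map_map,
    resultant_deriv (natDegree_pos_iff_degree_pos.1 (hdeg.symm ▸ hn)), hg.leadingCoeff, hdeg,
    mul_one, map_mul, map_pow, map_neg, map_one] at hres
  exact (isUnit_one.neg.pow _).mul_left_cancel hres

theorem map_det_vandermonde {R : Type*} [CommRing R] {n : ℕ} (r : Fin n → R) (σ : R →+* R)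
    (π : Equiv.Perm (Fin n)) (hσ : ∀ i, σ (r i) = r (π i)) :
    σ (Matrix.vandermonde r).det = Equiv.Perm.sign π * (Matrix.vandermonde r).det := by
  rw [RingHom.map_det, ← Matrix.det_permute]
  congr 1
  ext i j
  simp [hσ]

theorem exists_sq_eq_map_discr {R M ι : Type*} [CommRing R] [CommRing M] [Nontrivial M] [Fintype ι]
    [DecidableEq ι] (φ : R →+* M) {g : R[X]} (hg : g.Monic) {r : ι → M}
    (hr : g.map φ = ∏ i, (X - C (r i))) :
    ∃ δ : M, φ g.discr = δ ^ 2 ∧ ∀ (σ : M →+* M) (π : Equiv.Perm ι), (∀ i, σ (r i) = r (π i)) →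
      σ δ = Equiv.Perm.sign π * δ := by
  let e := Fintype.equivFin ι
  refine ⟨(Matrix.vandermonde (r ∘ e.symm)).det, map_discr_eq_det_vandermonde_sq φ hg ?_,
    fun σ π hπ => ?_⟩
  · rw [hr, ← e.symm.prod_comp]
    rfl
  · rw [map_det_vandermonde _ σ (e.permCongr π) (by simp [hπ]), Equiv.Perm.sign_permCongr]

theorem valuation_sub_eq_one_of_valuation_discr_eq_one {R M Γ ι : Type*} [CommRing R] [CommRing M]
    [Nontrivial M] [LinearOrderedCommGroupWithZero Γ] [Fintype ι] (v : Valuation M Γ) (φ : R →+* M)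
    {g : R[X]} (hg : g.Monic) {r : ι → M} (hr : g.map φ = ∏ i, (X - C (r i)))
    (hint : ∀ i, v (r i) ≤ 1) (hv : v (φ g.discr) = 1) {i j : ι} (hij : i ≠ j) :
    v (r i - r j) = 1 := by
  let e := Fintype.equivFin ι
  have hle (a b : ι) : v (r a - r b) ≤ 1 := (v.map_sub _ _).trans (max_le (hint a) (hint b))
  rw [map_discr_eq_det_vandermonde_sq (r := r ∘ e.symm) φ hg
      (by rw [hr, ← e.symm.prod_comp]; rfl), map_pow, pow_eq_one_iff_of_nonneg zero_le two_ne_zero,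
    Matrix.det_vandermonde, Finset.prod_sigma', map_prod] at hv
  have hone :=
    (Finset.prod_eq_one_iff_of_le_one' fun x _ => hle (e.symm x.2) (e.symm x.1)).1 hv
  have hlt {a b : ι} (hab : e a < e b) : v (r b - r a) = 1 := by
    simpa using hone ⟨e a, e b⟩ (by simpa using hab)
  rcases (e.injective.ne hij).lt_or_gt with h | h
  · rw [v.map_sub_swap, hlt h]
  · exact hlt h

end Discriminant

section IterateComp

variable {R : Type*} [CommRing R] {f : R[X]}

theorem iterate_comp_X_succ (f : R[X]) (n : ℕ) : f.comp^[n + 1] X = (f.comp^[n] X).comp f := by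
  induction n with
  | zero => simp
  | succ n ih =>
    rw [Function.iterate_succ_apply', ih, ← comp_assoc, ← Function.iterate_succ_apply' f.comp, ih]

theorem monic_iterate_comp_X_sub_C (hf : f.Monic) (hd : f.natDegree ≠ 0) (x : R) (n : ℕ) :
    (f.comp^[n] X - C x).Monic := by
  induction n with
  | zero => exact monic_X_sub_C x
  | succ n ih =>
    rw [iterate_comp_X_succ, ← C_comp (p := f) (a := x), ← sub_comp]
    exact ih.comp hf hd

end IterateComp

section IterSubC

variable {K L : Type*} [Field K] [Field L] [Algebra K L] {f : K[X]} {x₀ : K}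

theorem aeval_iterSubC (f : K[X]) (x₀ : K) (n : ℕ) (y : L) :
    aeval y (iterSubC f x₀ n) = (fun z => aeval z f)^[n] y - algebraMap K L x₀ := by
  have h : aeval y (f.comp^[n] X) = (fun z => aeval z f)^[n] y := by
    induction n with
    | zero => simp
    | succ n ih =>
      rw [Function.iterate_succ_apply', aeval_comp, ih, Function.iterate_succ_apply']
  rw [iterSubC, map_sub, h, aeval_C]

theorem iterSubC_succ (f : K[X]) (x₀ : K) (n : ℕ) :
    iterSubC f x₀ (n + 1) = (iterSubC f x₀ n).comp f := by
  rw [iterSubC, iterate_comp_X_succ, iterSubC, sub_comp, C_comp]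

theorem monic_iterSubC (hf : f.Monic) (hd : f.natDegree ≠ 0) (x₀ : K) (n : ℕ) :
    (iterSubC f x₀ n).Monic :=
  monic_iterate_comp_X_sub_C hf hd x₀ n

theorem irreducible_of_irreducible_comp {g : K[X]} (hd : f.natDegree ≠ 0)
    (h : Irreducible (g.comp f)) : Irreducible g := by
  have : IsLocalHom (compRingHom f) := ⟨fun a ha => by
    have ha' : a ≠ 0 := by
      rintro rfl
      simp at ha
    refine isUnit_iff_degree_eq_zero.2 ((degree_eq_iff_natDegree_eq ha').2 ?_)
    have hcomp := natDegree_eq_zero_of_isUnit ha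
    rw [coe_compRingHom_apply, natDegree_comp] at hcomp
    exact (mul_eq_zero.1 hcomp).resolve_right hd⟩
  exact Irreducible.of_map (f := compRingHom f) h

theorem irreducible_iterSubC_of_le (hd : f.natDegree ≠ 0) {k n : ℕ} (hkn : k ≤ n)
    (h : Irreducible (iterSubC f x₀ n)) : Irreducible (iterSubC f x₀ k) := by
  induction hkn using Nat.decreasingInduction with
  | self => exact h
  | of_succ k _ ih =>
    rw [iterSubC_succ] at ih
    exact irreducible_of_irreducible_comp hd ih

theorem minpoly_eq_iterSubC (hf : f.Monic) (hd : f.natDegree ≠ 0) {n : ℕ}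
    (h : Irreducible (iterSubC f x₀ n)) {y : L}
    (hy : (fun z => aeval z f)^[n] y = algebraMap K L x₀) : minpoly K y = iterSubC f x₀ n :=
  (minpoly.eq_of_irreducible_of_monic h (by rw [aeval_iterSubC, hy, sub_self])
    (monic_iterSubC hf hd x₀ n)).symm

theorem splits_iterSubC_of_le [Normal K L] (hf : f.Monic) (hd : f.natDegree ≠ 0) {k n : ℕ}
    (hkn : k ≤ n) (h : Irreducible (iterSubC f x₀ n))
    (hs : ((iterSubC f x₀ n).map (algebraMap K L)).Splits) :
    ((iterSubC f x₀ k).map (algebraMap K L)).Splits := by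
  obtain ⟨z, hz⟩ := hs.exists_eval_eq_zero
    (by rw [degree_map]; exact (degree_pos_of_irreducible h).ne')
  rw [eval_map_algebraMap, aeval_iterSubC, sub_eq_zero, ← Nat.add_sub_cancel' hkn,
    Function.iterate_add_apply] at hz
  rw [← minpoly_eq_iterSubC hf hd (irreducible_iterSubC_of_le hd hkn h) hz]
  exact Normal.splits inferInstance _

theorem exists_smul_eq_of_irreducible_iterSubC [Normal K L] (hf : f.Monic)
    (hd : f.natDegree ≠ 0) {n : ℕ} (h : Irreducible (iterSubC f x₀ n)) {y z : L}
    (hy : (fun z => aeval z f)^[n] y = algebraMap K L x₀)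
    (hz : (fun z => aeval z f)^[n] z = algebraMap K L x₀) : ∃ σ : Gal(L/K), σ • y = z :=
  (Normal.minpoly_eq_iff_mem_orbit L).1
    ((minpoly_eq_iterSubC hf hd h hz).trans (minpoly_eq_iterSubC hf hd h hy).symm)

theorem natCard_aeval_fiber_eq {n : ℕ} (hsep : (iterSubC f x₀ (n + 1)).Separable)
    (hs : ((iterSubC f x₀ (n + 1)).map (algebraMap K L)).Splits) {y : L}
    (hy : (fun z => aeval z f)^[n] y = algebraMap K L x₀) :
    Nat.card {z : L // aeval z f = y} = f.natDegree := by
  have hroot : X - C y ∣ (iterSubC f x₀ n).map (algebraMap K L) := by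
    rw [dvd_iff_isRoot, IsRoot.def, eval_map_algebraMap, aeval_iterSubC, hy, sub_self]
  have hdvd : f.map (algebraMap K L) - C y ∣ (iterSubC f x₀ (n + 1)).map (algebraMap K L) := by
    rw [iterSubC_succ, map_comp]
    simpa using map_dvd (compRingHom (f.map (algebraMap K L))) hroot
  have hsep' := (hsep.map (f := algebraMap K L)).of_dvd hdvd
  have hs' := hs.of_dvd (hsep.map (f := algebraMap K L)).ne_zero hdvd
  have hcard := card_rootSet_eq_natDegree (K := L) hsep' (by simpa using hs')
  rw [natDegree_sub_C, natDegree_map, ← Nat.card_eq_fintype_card] at hcard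
  rw [← hcard]
  refine Nat.card_congr (Equiv.subtypeEquivRight fun z => ?_)
  rw [mem_rootSet_of_ne hsep'.ne_zero]
  simp [sub_eq_zero]

theorem finite_iterSubC_roots (hf : f.Monic) (hd : f.natDegree ≠ 0) (x₀ : K) (n : ℕ) :
    Finite {y : L // (fun z => aeval z f)^[n] y = algebraMap K L x₀} := by
  refine ((iterSubC f x₀ n).rootSet_finite L).subset fun y hy => ?_
  rw [mem_rootSet_of_ne (monic_iterSubC hf hd x₀ n).ne_zero, aeval_iterSubC, sub_eq_zero]
  exact hy

theorem map_iterSubC_eq_prod (hf : f.Monic) (hd : f.natDegree ≠ 0) {n : ℕ}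
    (hsep : (iterSubC f x₀ n).Separable) (hs : ((iterSubC f x₀ n).map (algebraMap K L)).Splits)
    [Fintype {y : L // (fun z => aeval z f)^[n] y = algebraMap K L x₀}] :
    (iterSubC f x₀ n).map (algebraMap K L) =
      ∏ y : {y : L // (fun z => aeval z f)^[n] y = algebraMap K L x₀}, (X - C (y : L)) := by
  classical
  have hm := (monic_iterSubC hf hd x₀ n).map (algebraMap K L)
  have hroots (y : L) : y ∈ ((iterSubC f x₀ n).map (algebraMap K L)).roots.toFinset ↔
      (fun z => aeval z f)^[n] y = algebraMap K L x₀ := by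
    rw [Multiset.mem_toFinset, mem_roots hm.ne_zero, IsRoot.def, eval_map_algebraMap,
      aeval_iterSubC, sub_eq_zero]
  rw [← Finset.prod_subtype _ hroots fun y => X - C y, Finset.prod, Multiset.toFinset_val,
    (nodup_roots hsep.map).dedup, ← hs.eq_prod_roots_of_monic hm]

end IterSubC

section Valuation

variable {K L Γ : Type*} [Field K] [Field L] [Algebra K L] [LinearOrderedCommGroupWithZero Γ]
  {v : Valuation L Γ} {f : K[X]}

theorem aeval_eq_coe_eval {g : v.integer[X]}
    (hg : g.map (algebraMap v.integer L) = f.map (algebraMap K L)) (y : v.integer) :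
    aeval (y : L) f = (g.eval y : v.integer) := by
  rw [← eval_map_algebraMap, ← hg, eval_map_algebraMap]
  exact aeval_algebraMap_apply_eq_algebraMap_eval y g

theorem valuation_aeval_le_one (hf : f.map (algebraMap K L) ∈ lifts (algebraMap v.integer L))
    {y : L} (hy : v y ≤ 1) : v (aeval y f) ≤ 1 := by
  obtain ⟨g, hg⟩ := hf
  rw [aeval_eq_coe_eval hg ⟨y, hy⟩]
  exact (g.eval ⟨y, hy⟩).2

theorem valuation_iterate_aeval_sub_le
    (hf : f.map (algebraMap K L) ∈ lifts (algebraMap v.integer L)) (n : ℕ) {y z : L}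
    (hy : v y ≤ 1) (hz : v z ≤ 1) :
    v ((fun u => aeval u f)^[n] y - (fun u => aeval u f)^[n] z) ≤ v (y - z) := by
  have hstep {y z : L} (hy : v y ≤ 1) (hz : v z ≤ 1) : v (aeval y f - aeval z f) ≤ v (y - z) := by
    obtain ⟨g, hg⟩ := hf
    obtain ⟨c, hc⟩ := sub_dvd_eval_sub (⟨y, hy⟩ : v.integer) ⟨z, hz⟩ g
    have hc' : aeval y f - aeval z f = (y - z) * c := by
      rw [aeval_eq_coe_eval hg ⟨y, hy⟩, aeval_eq_coe_eval hg ⟨z, hz⟩]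
      exact congrArg Subtype.val hc
    rw [hc', map_mul]
    exact mul_le_of_le_one_right' c.2
  induction n generalizing y z with
  | zero => rfl
  | succ n ih =>
    exact (ih (valuation_aeval_le_one hf hy) (valuation_aeval_le_one hf hz)).trans (hstep hy hz)

theorem valuation_le_one_of_iterate_aeval_eq
    (hf : f.map (algebraMap K L) ∈ lifts (algebraMap v.integer L)) (hm : f.Monic)
    (hd : f.natDegree ≠ 0) {x : L} (hx : v x ≤ 1) (n : ℕ) {y : L}
    (hy : (fun z => aeval z f)^[n] y = x) : v y ≤ 1 := by
  induction n generalizing y with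
  | zero => rwa [← hy] at hx
  | succ n ih =>
    obtain ⟨g, hg, hdeg, hgm⟩ := lifts_and_natDegree_eq_and_monic hf (hm.map _)
    have hgd : g.natDegree ≠ 0 := by rwa [hdeg, natDegree_map]
    let c : v.integer := ⟨aeval y f, ih hy⟩
    refine (Valuation.integer.integers v).mem_of_integral
      ⟨g - C c, hgm.sub_of_left ?_, ?_⟩
    · exact degree_C_le.trans_lt (natDegree_pos_iff_degree_pos.1 hgd.bot_lt)
    · rw [eval₂_sub, eval₂_C, ← eval_map, hg, eval_map_algebraMap]
      exact sub_self _

theorem valuation_derivative_le_of_aeval_eq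
    (hf : f.map (algebraMap K L) ∈ lifts (algebraMap v.integer L)) {y z : L} (hy : v y ≤ 1)
    (hz : v z ≤ 1) (hyz : y ≠ z) (h : aeval y f = aeval z f) :
    v (aeval y (derivative f)) ≤ v (y - z) := by
  obtain ⟨g, hg⟩ := hf
  have hg' : (derivative g).map (algebraMap v.integer L) = (derivative f).map (algebraMap K L) := by
    rw [← derivative_map, ← derivative_map, ← hg, coe_mapRingHom]
  obtain ⟨k, hk⟩ := g.binomExpansion (⟨y, hy⟩ : v.integer) (⟨z, hz⟩ - ⟨y, hy⟩)
  have hfac : aeval y (derivative f) = k * (y - z) := by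
    rw [aeval_eq_coe_eval hg ⟨y, hy⟩, aeval_eq_coe_eval hg ⟨z, hz⟩] at h
    rw [add_sub_cancel, ← Subtype.ext h] at hk
    rw [aeval_eq_coe_eval hg' ⟨y, hy⟩]
    have hk' := congrArg Subtype.val hk
    push_cast at hk'
    refine mul_left_cancel₀ (sub_ne_zero.2 hyz.symm) ?_
    linear_combination -hk'
  rw [hfac, map_mul]
  exact mul_le_of_le_one_left' k.2

end Valuation

section Binomial

variable {K L Γ : Type*} [Field K] [Field L] [Algebra K L] [LinearOrderedCommGroupWithZero Γ]
  {v : Valuation L Γ} {d : ℕ} {b x₀ : K}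

theorem natDegree_X_pow_sub_C_mul_X {R : Type*} [Ring R] [Nontrivial R] {d : ℕ} (hd : 2 ≤ d)
    (b : R) : (X ^ d - C b * X).natDegree = d := by
  have hlt : (C b * X).natDegree < (X ^ d : R[X]).natDegree := by
    rw [natDegree_X_pow]
    exact ((natDegree_C_mul_le b X).trans natDegree_X_le).trans_lt hd
  rw [natDegree_sub_eq_left_of_natDegree_lt hlt, natDegree_X_pow]

theorem monic_X_pow_sub_C_mul_X {R : Type*} [Ring R] {d : ℕ} (hd : 2 ≤ d) (b : R) :
    (X ^ d - C b * X).Monic :=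
  monic_X_pow_sub ((degree_C_mul_X_le b).trans_lt (by exact_mod_cast hd))

theorem aeval_X_pow_sub_C_mul_X (d : ℕ) (b : K) (y : L) :
    aeval y (X ^ d - C b * X) = y ^ d - algebraMap K L b * y := by
  simp

theorem aeval_derivative_X_pow_sub_C_mul_X (d : ℕ) (b : K) (y : L) :
    aeval y (derivative (X ^ d - C b * X)) = d * y ^ (d - 1) - algebraMap K L b := by
  simp [derivative_X_pow]

theorem map_X_pow_sub_C_mul_X_mem_lifts (d : ℕ) (hb : v (algebraMap K L b) ≤ 1) :
    (X ^ d - C b * X).map (algebraMap K L) ∈ lifts (algebraMap v.integer L) :=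
  ⟨X ^ d - C ⟨_, hb⟩ * X, by
    simp only [coe_mapRingHom, Polynomial.map_sub, Polynomial.map_mul, Polynomial.map_pow, map_X,
      map_C]
    rfl⟩

theorem valuation_aeval_sub_lt_one (hd : d = 2 ∨ d = 3) (hb : v (algebraMap K L b) ≤ 1)
    (hx : v (algebraMap K L x₀) = 1) (hvd : v (d : L) = 1) (hvd' : v ((d : L) - 1) = 1) {n : ℕ}
    {y z : L} (hy : (fun z => aeval z (X ^ d - C b * X))^[n] y = algebraMap K L x₀)
    (hz : (fun z => aeval z (X ^ d - C b * X))^[n] z = algebraMap K L x₀)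
    (hy' : v (aeval y (derivative (X ^ d - C b * X))) < 1)
    (hz' : v (aeval z (derivative (X ^ d - C b * X))) < 1) :
    v (aeval y (X ^ d - C b * X) - aeval z (X ^ d - C b * X)) < 1 := by
  have hd2 : 2 ≤ d := by omega
  have hint := map_X_pow_sub_C_mul_X_mem_lifts d hb
  have hroot {y : L} := valuation_le_one_of_iterate_aeval_eq hint (monic_X_pow_sub_C_mul_X hd2 b)
    (by rw [natDegree_X_pow_sub_C_mul_X hd2]; omega) hx.le n (y := y)
  have hdiff : aeval y (derivative (X ^ d - C b * X)) - aeval z (derivative (X ^ d - C b * X)) =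
      d * (y ^ (d - 1) - z ^ (d - 1)) := by
    rw [aeval_derivative_X_pow_sub_C_mul_X, aeval_derivative_X_pow_sub_C_mul_X]
    ring
  have hpow := v.map_sub_lt hy' hz'
  rw [hdiff, map_mul, hvd, one_mul] at hpow
  suffices v (y - z) < 1 from
    (valuation_iterate_aeval_sub_le hint 1 (hroot hy) (hroot hz)).trans_lt this
  rcases hd with rfl | rfl
  · simpa using hpow
  · have hcomm : Function.Commute (fun u : L => aeval u (X ^ 3 - C b * X)) Neg.neg := fun u => by
      simp only [aeval_X_pow_sub_C_mul_X]
      ring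
    have hneg : (fun u : L => aeval u (X ^ 3 - C b * X))^[n] (-z) = -algebraMap K L x₀ :=
      (hcomm.iterate_left n z).trans (congrArg _ hz)
    have hadd := valuation_iterate_aeval_sub_le hint n (hroot hy) (v.map_neg z ▸ hroot hz)
    have htwo : algebraMap K L x₀ - -algebraMap K L x₀ =
        (((3 : ℕ) : L) - 1) * algebraMap K L x₀ := by
      push_cast
      ring
    rw [hy, hneg, htwo, map_mul, hvd', hx, one_mul, sub_neg_eq_add] at hadd
    have hfac : y ^ (3 - 1) - z ^ (3 - 1) = (y + z) * (y - z) := by ring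
    rw [hfac, map_mul] at hpow
    exact (le_mul_of_one_le_left' hadd).trans_lt hpow

end Binomial

section Inertia

theorem valuation_sub_lt_one_of_mem_inertia {K L : Type*} [Field K] [Field L] [NumberField L]
    [Algebra K L] (Q : HeightOneSpectrum (𝓞 L)) {σ : Gal(L/K)}
    (hσ : σ ∈ Q.asIdeal.inertia Gal(L/K)) {z : L} (hz : Q.valuation L z ≤ 1) :
    Q.valuation L (σ z - z) < 1 := by
  obtain ⟨a, c, hac⟩ := Q.exists_primeCompl_mul_eq_of_integer z hz
  have hlt (u : 𝓞 L) : Q.valuation L (σ (algebraMap (𝓞 L) L u) - algebraMap (𝓞 L) L u) < 1 :=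
    (Q.valuation_lt_one_iff_mem (K := L) (σ • u - u)).2 (hσ u)
  have hc : Q.valuation L (algebraMap (𝓞 L) L c) = 1 := Q.valuation_eq_one_iff_notMem.2 c.2
  have hσc : Q.valuation L (σ (algebraMap (𝓞 L) L c)) = 1 := by
    have hsum := (Q.valuation L).map_add_eq_of_lt_right (hc.symm ▸ hlt c)
    rwa [sub_add_cancel, hc] at hsum
  have hzc : Q.valuation L (z * (σ (algebraMap (𝓞 L) L c) - algebraMap (𝓞 L) L c)) < 1 := by
    rw [map_mul]
    exact (mul_le_of_le_one_left' hz).trans_lt (hlt c)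
  have hmul : (σ z - z) * σ (algebraMap (𝓞 L) L c) = (σ (algebraMap (𝓞 L) L a) -
      algebraMap (𝓞 L) L a) - z * (σ (algebraMap (𝓞 L) L c) - algebraMap (𝓞 L) L c) := by
    have hσac := congrArg σ hac
    rw [map_mul] at hσac
    linear_combination hσac - hac
  have hdiff := (Q.valuation L).map_sub_lt (hlt a) hzc
  rwa [← hmul, map_mul, hσc, mul_one] at hdiff

variable {K L : Type*} [Field K] [NumberField K] [Field L] [NumberField L] [Algebra K L]
  [IsGalois K L]

open scoped Pointwise in
theorem ramificationIdx'_under_fixedPoints_inertia {p : Ideal (𝓞 K)} [p.IsMaximal]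
    (hp : p ≠ ⊥) (P : Ideal (𝓞 L)) [P.IsPrime] [P.LiesOver p] :
    (P.under (𝓞 (FixedPoints.intermediateField (P.inertia Gal(L/K)) :
      IntermediateField K L))).ramificationIdx' P = p.ramificationIdx' P := by
  let I := P.inertia Gal(L/K)
  let F : IntermediateField K L := FixedPoints.intermediateField I
  let q := P.under (𝓞 F)
  have hq : q ≠ ⊥ := Ideal.IsIntegral.comap_ne_bot _ (Ideal.ne_bot_of_liesOver_of_ne_bot hp P)
  have : q.LiesOver p := Ideal.LiesOver.tower_bot P q p
  have : Finite (𝓞 K ⧸ p) := Ring.HasFiniteQuotients.finiteQuotient hp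
  have : Finite (𝓞 F ⧸ q) := Ring.HasFiniteQuotients.finiteQuotient hq
  have : IsGaloisGroup I F L := IsGaloisGroup.subgroup Gal(L/K) K L I
  have : IsGaloisGroup Gal(L/K) (𝓞 K) (𝓞 L) := .of_isFractionRing _ _ _ K L
  have : IsGaloisGroup I (𝓞 F) (𝓞 L) := .of_isFractionRing _ _ _ F L
  have hcard := Ideal.card_inertia_eq_ramificationIdxIn (G := Gal(L/K)) p P
  have hcard' := Ideal.card_inertia_eq_ramificationIdxIn (G := I) q P
  rw [Ideal.ramificationIdxIn_eq_ramificationIdx p P Gal(L/K)] at hcard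
  have htop : P.inertia I = ⊤ := eq_top_iff.2 fun σ _ => σ.2
  rw [Ideal.ramificationIdxIn_eq_ramificationIdx q P I, htop, Subgroup.card_top] at hcard'
  rw [Ideal.ramificationIdx'_eq_ramificationIdx _ _ hq,
    Ideal.ramificationIdx'_eq_ramificationIdx _ _ hp, ← hcard, ← hcard']

variable (p : HeightOneSpectrum (𝓞 K)) (Q : HeightOneSpectrum (𝓞 L))
  [Q.asIdeal.LiesOver p.asIdeal]

theorem exists_valuation_eq_exp_pow_of_inertia_fixed {y : L} (hy : y ≠ 0)
    (hfix : ∀ σ ∈ Q.asIdeal.inertia Gal(L/K), σ y = y) :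
    ∃ m : ℤ, Q.valuation L y = WithZero.exp m ^ p.asIdeal.ramificationIdx' Q.asIdeal := by
  let F : IntermediateField K L := FixedPoints.intermediateField (Q.asIdeal.inertia Gal(L/K))
  let q : HeightOneSpectrum (𝓞 F) :=
    ⟨Q.asIdeal.under (𝓞 F), inferInstance, Ideal.IsIntegral.comap_ne_bot _ Q.ne_bot⟩
  have : Q.asIdeal.LiesOver q.asIdeal := ⟨rfl⟩
  have : p.asIdeal.IsMaximal := p.isMaximal
  let z : F := ⟨y, fun σ => hfix σ σ.2⟩
  have hz : z ≠ 0 := fun h => hy (congrArg Subtype.val h)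
  refine ⟨WithZero.log (q.valuation F z), ?_⟩
  rw [WithZero.exp_log ((q.valuation F).ne_zero_iff.2 hz),
    ← ramificationIdx'_under_fixedPoints_inertia p.ne_bot Q.asIdeal]
  exact (HeightOneSpectrum.valuation_liesOver L q Q z).symm

theorem exists_inertia_apply_ne_of_odd {y : L} {a : K} (hya : y ^ 2 = algebraMap K L a) {k : ℤ}
    (hk : Odd k) (ha : HasOrd p a k) : ∃ σ ∈ Q.asIdeal.inertia Gal(L/K), σ y ≠ y := by
  by_contra! hfix
  have he : p.asIdeal.ramificationIdx' Q.asIdeal ≠ 0 :=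
    Ideal.IsDedekindDomain.ramificationIdx'_ne_zero_of_liesOver _ p.ne_bot
  have hsq : Q.valuation L y ^ 2 = WithZero.exp (-k) ^ p.asIdeal.ramificationIdx' Q.asIdeal := by
    rw [← map_pow, hya, ← HeightOneSpectrum.valuation_liesOver L p Q a,
      show p.valuation K a = _ from ha]
  have hy : y ≠ 0 := by
    rintro rfl
    rw [map_zero, zero_pow two_ne_zero] at hsq
    exact pow_ne_zero _ WithZero.exp_ne_zero hsq.symm
  obtain ⟨m, hm⟩ := exists_valuation_eq_exp_pow_of_inertia_fixed p Q hy hfix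
  rw [hm, pow_right_comm, pow_left_inj₀ zero_le zero_le he, ← WithZero.exp_nsmul,
    WithZero.exp_inj] at hsq
  refine Int.not_even_iff_odd.2 hk (even_neg.1 (hsq ▸ ?_))
  exact ⟨m, two_nsmul m⟩

end Inertia

theorem isSwap_of_sign_eq_neg_one {α : Type*} [Fintype α] [DecidableEq α] {π : Equiv.Perm α}
    (hπ : Equiv.Perm.sign π = -1) (hcard : π.support.card ≤ 3) : π.IsSwap := by
  have h0 : π.support.card ≠ 0 := fun h => by
    rw [Equiv.Perm.card_support_eq_zero.1 h, Equiv.Perm.sign_one] at hπ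
    exact absurd hπ (by decide)
  have h3 : π.support.card ≠ 3 := fun h => by
    rw [(card_support_eq_three_iff.1 h).sign] at hπ
    exact absurd hπ (by decide)
  have h1 := π.card_support_ne_one
  exact Equiv.Perm.card_support_eq_two.1 (by omega)

section Arboreal

variable {K L : Type*} [Field K] [Field L] [Algebra K L]

theorem commute_smul_aeval (f : K[X]) (σ : Gal(L/K)) :
    Function.Commute (σ • ·) fun y : L => aeval y f :=
  fun y => (aeval_algHom_apply σ y f).symm

/-- The arboreal representation: the action of the Galois group on the `n`-th preimages of `x₀`
under `f` in `L`. -/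
noncomputable def galPreimageHom (L : Type*) [Field L] [Algebra K L] (f : K[X]) (x₀ : K) (n : ℕ) :
    Gal(L/K) →* Equiv.Perm {y : L // (fun z => aeval z f)^[n] y = algebraMap K L x₀} :=
  preimagePermHom (commute_smul_aeval f) (fun σ => σ.commutes x₀) n

end Arboreal

section Ramification

variable {K L : Type*} [Field K] [NumberField K] [Field L] [NumberField L] [Algebra K L]
  {p : HeightOneSpectrum (𝓞 K)} (Q : HeightOneSpectrum (𝓞 L)) [Q.asIdeal.LiesOver p.asIdeal]
  {f : K[X]} {x₀ : K} {n : ℕ}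

theorem HasOrd.valuation_algebraMap_eq_one {a : K} (ha : HasOrd p a 0) :
    Q.valuation L (algebraMap K L a) = 1 := by
  rw [← HeightOneSpectrum.valuation_liesOver L p Q a, show p.valuation K a = _ from ha, neg_zero,
    WithZero.exp_zero, one_pow]

theorem exists_inertia_sign_eq_neg_one [IsGalois K L]
    [Fintype {y : L // (fun z => aeval z f)^[n] y = algebraMap K L x₀}]
    [DecidableEq {y : L // (fun z => aeval z f)^[n] y = algebraMap K L x₀}]
    (hf : f.Monic) (hd : f.natDegree ≠ 0) (hsep : (iterSubC f x₀ n).Separable)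
    (hs : ((iterSubC f x₀ n).map (algebraMap K L)).Splits) {k : ℤ} (hk : Odd k)
    (hdisc : HasOrd p (iterSubC f x₀ n).discr k) :
    ∃ σ ∈ Q.asIdeal.inertia Gal(L/K), Equiv.Perm.sign (galPreimageHom L f x₀ n σ) = -1 := by
  obtain ⟨δ, hδ, hsign⟩ := exists_sq_eq_map_discr (algebraMap K L) (monic_iterSubC hf hd x₀ n)
    (map_iterSubC_eq_prod hf hd hsep hs)
  obtain ⟨σ, hσ, hne⟩ := exists_inertia_apply_ne_of_odd p Q hδ.symm hk hdisc
  refine ⟨σ, hσ, (Int.units_eq_one_or _).resolve_left fun h => hne ?_⟩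
  simpa [h] using hsign σ (galPreimageHom L f x₀ n σ) fun y => rfl

theorem valuation_sub_eq_one_of_hasOrd_discr
    (hf : f.map (algebraMap K L) ∈ lifts (algebraMap (Q.valuation L).integer L)) (hm : f.Monic)
    (hd : f.natDegree ≠ 0) (hx : Q.valuation L (algebraMap K L x₀) ≤ 1)
    (hsep : (iterSubC f x₀ n).Separable) (hs : ((iterSubC f x₀ n).map (algebraMap K L)).Splits)
    (hdisc : HasOrd p (iterSubC f x₀ n).discr 0) {y z : L}
    (hy : (fun z => aeval z f)^[n] y = algebraMap K L x₀)
    (hz : (fun z => aeval z f)^[n] z = algebraMap K L x₀) (hyz : y ≠ z) :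
    Q.valuation L (y - z) = 1 := by
  have := finite_iterSubC_roots (L := L) hm hd x₀ n
  have := Fintype.ofFinite {y : L // (fun z => aeval z f)^[n] y = algebraMap K L x₀}
  exact valuation_sub_eq_one_of_valuation_discr_eq_one (Q.valuation L) (algebraMap K L)
    (monic_iterSubC hm hd x₀ n) (map_iterSubC_eq_prod hm hd hsep hs)
    (fun y => valuation_le_one_of_iterate_aeval_eq hf hm hd hx n y.2)
    (hdisc.valuation_algebraMap_eq_one Q) (i := ⟨y, hy⟩) (j := ⟨z, hz⟩)
    fun h => hyz (congrArg Subtype.val h)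

end Ramification

section Transposition

variable {K L : Type*} [Field K] [Field L] [Algebra K L] {d : ℕ} {b x₀ : K} {n : ℕ}

theorem aeval_eq_of_apply_ne {Γ : Type*} [LinearOrderedCommGroupWithZero Γ] {v : Valuation L Γ}
    (hd : d = 2 ∨ d = 3) (hb : v (algebraMap K L b) ≤ 1) (hx : v (algebraMap K L x₀) = 1)
    (hvd : v (d : L) = 1) (hvd' : v ((d : L) - 1) = 1)
    (hn : ∀ y z : L, (fun u => aeval u (X ^ d - C b * X))^[n] y = algebraMap K L x₀ →
      (fun u => aeval u (X ^ d - C b * X))^[n] z = algebraMap K L x₀ → y ≠ z → v (y - z) = 1)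
    {σ : Gal(L/K)} (hσ : ∀ z, v z ≤ 1 → v (σ z - z) < 1) {y z : L}
    (hy : (fun u => aeval u (X ^ d - C b * X))^[n + 1] y = algebraMap K L x₀)
    (hz : (fun u => aeval u (X ^ d - C b * X))^[n + 1] z = algebraMap K L x₀)
    (hσy : σ y ≠ y) (hσz : σ z ≠ z) :
    aeval y (X ^ d - C b * X) = aeval z (X ^ d - C b * X) := by
  have hd2 : 2 ≤ d := by omega
  have hint := map_X_pow_sub_C_mul_X_mem_lifts d hb
  have hroot {k : ℕ} {y : L} := valuation_le_one_of_iterate_aeval_eq hint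
    (monic_X_pow_sub_C_mul_X hd2 b) (by rw [natDegree_X_pow_sub_C_mul_X hd2]; omega) hx.le k
    (y := y)
  have hmem {k : ℕ} {y : L}
      (hy : (fun u => aeval u (X ^ d - C b * X))^[k] y = algebraMap K L x₀) :
      (fun u => aeval u (X ^ d - C b * X))^[k] (σ y) = algebraMap K L x₀ :=
    (galPreimageHom L (X ^ d - C b * X) x₀ k σ ⟨y, hy⟩).2
  have hfix {y : L} (hy : (fun u => aeval u (X ^ d - C b * X))^[n] y = algebraMap K L x₀) :
      σ y = y := by
    by_contra hne
    exact (hσ y (hroot hy)).ne (hn _ _ (hmem hy) hy hne)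
  have hder {y : L} (hy : (fun u => aeval u (X ^ d - C b * X))^[n + 1] y = algebraMap K L x₀)
      (hne : σ y ≠ y) : v (aeval y (derivative (X ^ d - C b * X))) < 1 := by
    have hσf : aeval (σ y) (X ^ d - C b * X) = aeval y (X ^ d - C b * X) :=
      (aeval_algHom_apply σ y _).trans (hfix hy)
    refine (valuation_derivative_le_of_aeval_eq hint (hroot hy) (hroot (hmem hy)) hne.symm
      hσf.symm).trans_lt ?_
    rw [v.map_sub_swap]
    exact hσ y (hroot hy)
  by_contra hne
  exact (valuation_aeval_sub_lt_one hd hb hx hvd hvd' hy hz (hder hy hσy) (hder hz hσz)).ne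
    (hn _ _ hy hz hne)

theorem isSwap_galPreimageHom {f : K[X]}
    [Fintype {y : L // (fun u => aeval u f)^[n + 1] y = algebraMap K L x₀}]
    [DecidableEq {y : L // (fun u => aeval u f)^[n + 1] y = algebraMap K L x₀}]
    (hd : f.natDegree ≠ 0) (hd3 : f.natDegree ≤ 3) (hsep : (iterSubC f x₀ (n + 1)).Separable)
    (hs : ((iterSubC f x₀ (n + 1)).map (algebraMap K L)).Splits) {σ : Gal(L/K)}
    (hsign : Equiv.Perm.sign (galPreimageHom L f x₀ (n + 1) σ) = -1)
    (hfiber : ∀ y z : L, (fun u => aeval u f)^[n + 1] y = algebraMap K L x₀ →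
      (fun u => aeval u f)^[n + 1] z = algebraMap K L x₀ → σ y ≠ y → σ z ≠ z →
        aeval y f = aeval z f) :
    (galPreimageHom L f x₀ (n + 1) σ).IsSwap := by
  refine isSwap_of_sign_eq_neg_one hsign ?_
  have hmoved {y} (hy : y ∈ (galPreimageHom L f x₀ (n + 1) σ).support) : σ (y : L) ≠ y :=
    fun h => Equiv.Perm.mem_support.1 hy (Subtype.ext h)
  rcases (galPreimageHom L f x₀ (n + 1) σ).support.eq_empty_or_nonempty with h | ⟨z, hz⟩
  · exact (Finset.card_eq_zero.2 h).trans_le (Nat.zero_le 3)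
  have hcard : Nat.card {y : L // aeval y f = aeval (z : L) f} = f.natDegree :=
    natCard_aeval_fiber_eq hsep hs z.2
  have := Nat.finite_of_card_ne_zero (hcard.trans_ne hd)
  rw [← Nat.card_eq_finsetCard]
  exact (Nat.card_le_card_of_injective (fun y : (galPreimageHom L f x₀ (n + 1) σ).support =>
    (⟨y.1, hfiber _ _ y.1.2 z.2 (hmoved y.2) (hmoved hz)⟩ :
      {y : L // aeval y f = aeval (z : L) f}))
    fun y y' h => Subtype.ext (Subtype.ext (Subtype.mk.inj h))).trans (hcard.trans_le hd3)

theorem exists_swap_mem_range_galPreimageHom [NumberField K] [NumberField L] [IsGalois K L]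
    [DecidableEq L] (hd : d = 2 ∨ d = 3) {p : HeightOneSpectrum (𝓞 K)}
    (hsep : ∀ k ≤ n + 1, (iterSubC (X ^ d - C b * X) x₀ k).Separable)
    (hs : ∀ k ≤ n + 1, ((iterSubC (X ^ d - C b * X) x₀ k).map (algebraMap K L)).Splits)
    (hb : p.valuation K b ≤ 1) (hx : HasOrd p x₀ 0) (hpd : HasOrd p (d : K) 0)
    (hpd' : HasOrd p ((d : K) - 1) 0) (hn : HasOrd p (iterSubC (X ^ d - C b * X) x₀ n).discr 0)
    {k : ℤ} (hk : Odd k) (hdisc : HasOrd p (iterSubC (X ^ d - C b * X) x₀ (n + 1)).discr k) :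
    ∃ y z : {y : L // (fun u => aeval u (X ^ d - C b * X))^[n + 1] y = algebraMap K L x₀},
      y ≠ z ∧ aeval (y : L) (X ^ d - C b * X) = aeval (z : L) (X ^ d - C b * X) ∧
        Equiv.swap y z ∈ (galPreimageHom L (X ^ d - C b * X) x₀ (n + 1)).range := by
  have hd2 : 2 ≤ d := by omega
  have hm := monic_X_pow_sub_C_mul_X hd2 b
  have hdeg := natDegree_X_pow_sub_C_mul_X hd2 b
  have hdeg0 : (X ^ d - C b * X).natDegree ≠ 0 := by omega
  obtain ⟨⟨P, hP, hPp⟩⟩ := (inferInstance : Nonempty (p.asIdeal.primesOver (𝓞 L)))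
  let Q : HeightOneSpectrum (𝓞 L) := ⟨P, hP, Ideal.ne_bot_of_liesOver_of_ne_bot p.ne_bot P⟩
  have : Q.asIdeal.LiesOver p.asIdeal := hPp
  have := finite_iterSubC_roots (L := L) hm hdeg0 x₀ (n + 1)
  have := Fintype.ofFinite
    {y : L // (fun u => aeval u (X ^ d - C b * X))^[n + 1] y = algebraMap K L x₀}
  have hQb : Q.valuation L (algebraMap K L b) ≤ 1 := by
    rw [← HeightOneSpectrum.valuation_liesOver L p Q b]
    exact pow_le_one' hb _
  have hQx := hx.valuation_algebraMap_eq_one (L := L) Q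
  obtain ⟨σ, hσ, hsign⟩ :=
    exists_inertia_sign_eq_neg_one Q hm hdeg0 (hsep _ le_rfl) (hs _ le_rfl) hk hdisc
  have hfiber (y z : L) := aeval_eq_of_apply_ne (y := y) (z := z) hd hQb hQx
    (by simpa using hpd.valuation_algebraMap_eq_one (L := L) Q)
    (by simpa using hpd'.valuation_algebraMap_eq_one (L := L) Q)
    (fun y z => valuation_sub_eq_one_of_hasOrd_discr Q (map_X_pow_sub_C_mul_X_mem_lifts d hQb) hm
      hdeg0 hQx.le (hsep n n.le_succ) (hs n n.le_succ) hn)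
    (fun z => valuation_sub_lt_one_of_mem_inertia Q hσ)
  obtain ⟨y, z, hyz, hswap⟩ :=
    isSwap_galPreimageHom hdeg0 (by omega) (hsep _ le_rfl) (hs _ le_rfl) hsign hfiber
  have hmove (u v) (huv : galPreimageHom L (X ^ d - C b * X) x₀ (n + 1) σ u = v) (hne : v ≠ u) :
      σ (u : L) ≠ u := fun h => hne (huv.symm.trans (Subtype.ext h))
  refine ⟨y, z, hyz, hfiber y z y.2 z.2 (hmove y z ?_ hyz.symm) (hmove z y ?_ hyz), σ, ?_⟩
  · rw [hswap, Equiv.swap_apply_left]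
  · rw [hswap, Equiv.swap_apply_right]
  · exact hswap

end Transposition

section Galois

variable {K L : Type*} [Field K] [Field L] [Algebra K L] {f : K[X]} {x₀ : K} {n : ℕ}

theorem galPreimageHom_injective [IsSplittingField K L (iterSubC f x₀ n)] :
    Function.Injective (galPreimageHom L f x₀ n) := by
  refine (injective_iff_map_eq_one _).2 fun σ hσ => AlgEquiv.coe_toAlgHom_injective <|
    AlgHom.ext_of_adjoin_eq_top (IsSplittingField.adjoin_rootSet L (iterSubC f x₀ n))
      fun y hy => ?_
  have hy' : (fun z => aeval z f)^[n] y = algebraMap K L x₀ := by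
    rw [← sub_eq_zero, ← aeval_iterSubC]
    exact aeval_eq_zero_of_mem_rootSet hy
  exact congrArg Subtype.val (DFunLike.congr_fun hσ ⟨y, hy'⟩)

theorem range_galPreimageHom_eq [PerfectField K] [Normal K L] [DecidableEq L] (hf : f.Monic)
    (hp : f.natDegree.Prime) (hirr : Irreducible (iterSubC f x₀ n))
    (hs : ((iterSubC f x₀ n).map (algebraMap K L)).Splits)
    (hswap : ∀ k < n, ∃ y z : {y : L // (fun u => aeval u f)^[k + 1] y = algebraMap K L x₀},
      y ≠ z ∧ aeval (y : L) f = aeval (z : L) f ∧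
        Equiv.swap y z ∈ (galPreimageHom L f x₀ (k + 1)).range) :
    (galPreimageHom L f x₀ n).range =
      preimageTreeAut (fun y : L => aeval y f) (algebraMap K L x₀) n := by
  have hirr' {k} (hk : k ≤ n) := irreducible_iterSubC_of_le hp.ne_zero hk hirr
  exact range_preimagePermHom_eq _ _ hp
    (fun k hk y hy => natCard_aeval_fiber_eq (PerfectField.separable_of_irreducible (hirr' hk))
      (splits_iterSubC_of_le hf hp.ne_zero hk hirr hs) hy)
    (fun k hk y z => exists_smul_eq_of_irreducible_iterSubC hf hp.ne_zero (hirr' hk) y.2 z.2) hswap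

theorem isSplittingField_preimageField (h : iterSubC f x₀ n ≠ 0) :
    IsSplittingField K (preimageField f x₀ n) (iterSubC f x₀ n) := by
  have hroots : (iterSubC f x₀ n).rootSet (AlgebraicClosure K) = iterPreimage f x₀ n := by
    ext y
    rw [mem_rootSet_of_ne h, aeval_iterSubC, sub_eq_zero]
    rfl
  rw [preimageField, ← hroots]
  exact IntermediateField.adjoin_rootSet_isSplittingField (IsAlgClosed.splits _)

end Galois

section Eisenstein

theorem map_iterate_comp_X {R S : Type*} [CommSemiring R] [CommSemiring S] (φ : R →+* S) (f : R[X])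
    (n : ℕ) : (f.comp^[n] X).map φ = (f.map φ).comp^[n] X := by
  rw [Function.Semiconj.iterate_right (f := map φ) (fun g => map_comp φ f g) n X, map_X]

theorem iterate_X_pow_comp_X {R : Type*} [CommSemiring R] (d n : ℕ) :
    (X ^ d : R[X]).comp^[n] X = X ^ d ^ n := by
  induction n with
  | zero => rw [pow_zero, pow_one, Function.iterate_zero_apply]
  | succ n ih => rw [Function.iterate_succ_apply', ih, X_pow_comp, ← pow_mul, pow_succ]

theorem isEisensteinAt_iterate_comp_sub_C {R : Type*} [CommRing R] {P : Ideal R} (hP : P ≠ ⊤)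
    {f : R[X]} (hf : f.Monic) (hd : f.natDegree ≠ 0)
    (hmap : f.map (Ideal.Quotient.mk P) = X ^ f.natDegree) (h0 : f.eval 0 = 0) {x : R} (hx : x ∈ P)
    (hx2 : x ∉ P ^ 2) (n : ℕ) : (f.comp^[n] X - C x).IsEisensteinAt P where
  leading := by
    rw [(monic_iterate_comp_X_sub_C hf hd x n).leadingCoeff]
    exact (Ideal.ne_top_iff_one P).1 hP
  mem {i} hi := by
    have := Ideal.Quotient.nontrivial_iff.2 hP
    have hred : (f.comp^[n] X - C x).map (Ideal.Quotient.mk P) = X ^ f.natDegree ^ n := by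
      rw [Polynomial.map_sub, map_iterate_comp_X, hmap, iterate_X_pow_comp_X, map_C,
        Ideal.Quotient.eq_zero_iff_mem.2 hx, C_0, sub_zero]
    rw [← (monic_iterate_comp_X_sub_C hf hd x n).natDegree_map (Ideal.Quotient.mk P), hred,
      natDegree_X_pow] at hi
    rw [← Ideal.Quotient.eq_zero_iff_mem, ← coeff_map, hred, coeff_X_pow, if_neg hi.ne]
  notMem := by
    rwa [coeff_zero_eq_eval_zero, eval_sub, iterate_comp_eval, eval_X, Function.iterate_fixed h0,
      eval_C, zero_sub, neg_mem_iff]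

theorem valuation_le_exp_neg_two_of_mem_maximalIdeal_sq {K : Type*} [Field K]
    (v : Valuation K (WithZero (Multiplicative ℤ))) {x : v.valuationSubring}
    (hx : x ∈ IsLocalRing.maximalIdeal v.valuationSubring ^ 2) :
    v (x : K) ≤ WithZero.exp (-2 : ℤ) := by
  have hle {y : v.valuationSubring} (hy : y ∈ IsLocalRing.maximalIdeal v.valuationSubring) :
      v (y : K) ≤ WithZero.exp (-1 : ℤ) := by
    rw [← WithZero.lt_mul_exp_iff_le WithZero.exp_ne_zero, ← WithZero.exp_add]
    exact (Valuation.mem_maximalIdeal_iff K v).1 hy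
  rw [pow_two] at hx
  induction hx using Submodule.mul_induction_on' with
  | mem_mul_mem y hy z hz => exact (v.map_mul y z).trans_le (mul_le_mul' (hle hy) (hle hz))
  | add y _ z _ hy hz => exact (v.map_add _ _).trans (max_le hy hz)

theorem irreducible_iterSubC {K : Type*} [Field K] {v : Valuation K (WithZero (Multiplicative ℤ))}
    {d : ℕ} (hd : 2 ≤ d) {b x₀ : K} (hb : v b < 1) (hx : v x₀ = WithZero.exp (-1 : ℤ)) (n : ℕ) :
    Irreducible (iterSubC (X ^ d - C b * X) x₀ n) := by
  have hx1 : v x₀ < 1 := by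
    rw [hx, ← WithZero.exp_zero, WithZero.exp_lt_exp]
    exact neg_one_lt_zero
  let B : v.valuationSubring := ⟨b, hb.le⟩
  let x : v.valuationSubring := ⟨x₀, hx1.le⟩
  have hB : B ∈ IsLocalRing.maximalIdeal v.valuationSubring :=
    (Valuation.mem_maximalIdeal_iff K v).2 hb
  have hfm := monic_X_pow_sub_C_mul_X hd B
  have hfd := natDegree_X_pow_sub_C_mul_X hd B
  have hfd0 : (X ^ d - C B * X).natDegree ≠ 0 := by omega
  have hm := monic_iterate_comp_X_sub_C hfm hfd0 x n
  have hx2 : x ∉ IsLocalRing.maximalIdeal v.valuationSubring ^ 2 := fun h => by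
    have h2 := valuation_le_exp_neg_two_of_mem_maximalIdeal_sq v h
    rw [hx, WithZero.exp_le_exp] at h2
    omega
  have heis := isEisensteinAt_iterate_comp_sub_C (IsLocalRing.maximalIdeal.isMaximal _).ne_top
    hfm hfd0 (by simp [hfd, Ideal.Quotient.eq_zero_iff_mem.2 hB])
    (by simp [show d ≠ 0 by omega]) ((Valuation.mem_maximalIdeal_iff K v).2 hx1) hx2 n
  have hmap : ((X ^ d - C B * X).comp^[n] X - C x).map (algebraMap v.valuationSubring K) =
      iterSubC (X ^ d - C b * X) x₀ n := by
    rw [Polynomial.map_sub, map_iterate_comp_X, map_C, iterSubC, Polynomial.map_sub,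
      Polynomial.map_mul, Polynomial.map_pow, map_X, map_C]
    rfl
  rw [← hmap, ← hm.irreducible_iff_irreducible_map_fraction_map]
  refine heis.irreducible inferInstance hm.isPrimitive ?_
  rw [natDegree_sub_C, natDegree_iterate_comp, natDegree_X, hfd]
  positivity

end Eisenstein

section NumberField

variable {K : Type*} [Field K] [NumberField K] {d : ℕ} {n : ℕ}

theorem hasOrd_coe_zero_of_notMem {p : HeightOneSpectrum (𝓞 K)} {r a : 𝓞 K} (ha : a ∉ p.asIdeal)
    (hr : r ∣ a) : HasOrd p (r : K) 0 := by
  rw [HasOrd, neg_zero, WithZero.exp_zero]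
  exact p.valuation_eq_one_iff_notMem.2 fun h => ha (Ideal.mem_of_dvd _ hr h)

theorem HasOrd.div_zero {p : HeightOneSpectrum (𝓞 K)} {a c : K} (ha : HasOrd p a 0)
    (hc : HasOrd p c 0) : HasOrd p (a / c) 0 := by
  rw [HasOrd] at *
  rw [map_div₀, ha, hc, neg_zero, WithZero.exp_zero, div_one]

theorem hasOrd_zero_of_mul_notMem {p : HeightOneSpectrum (𝓞 K)} {s t u w : 𝓞 K}
    (h : s * t * u * w * (d : 𝓞 K) * ((d : 𝓞 K) - 1) ∉ p.asIdeal) :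
    HasOrd p ((s : K) / (t : K)) 0 ∧ HasOrd p ((u : K) / (w : K)) 0 ∧ HasOrd p (d : K) 0 ∧
      HasOrd p ((d : K) - 1) 0 := by
  have hord (r : 𝓞 K) := hasOrd_coe_zero_of_notMem (r := r) h
  have hs := hord s ⟨t * u * w * d * (d - 1), by ring⟩
  have ht := hord t ⟨s * u * w * d * (d - 1), by ring⟩
  have hu := hord u ⟨s * t * w * d * (d - 1), by ring⟩
  have hw := hord w ⟨s * t * u * d * (d - 1), by ring⟩
  have hd := hord d ⟨s * t * u * w * (d - 1), by ring⟩
  have hd' := hord (d - 1) ⟨s * t * u * w * d, by ring⟩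
  exact ⟨hs.div_zero ht, hu.div_zero hw, by simpa using hd, by simpa using hd'⟩

theorem theorem3p2_general (hd : d = 2 ∨ d = 3) {b x₀ : K}
    (hirr : Irreducible (iterSubC (X ^ d - C b * X) x₀ n))
    (hram : ∀ m < n, ∃ 𝔭 : HeightOneSpectrum (𝓞 K),
      𝔭.valuation K b ≤ 1 ∧ HasOrd 𝔭 x₀ 0 ∧ HasOrd 𝔭 (d : K) 0 ∧ HasOrd 𝔭 ((d : K) - 1) 0 ∧
      (∃ k, Odd k ∧ HasOrd 𝔭 (iterSubC (X ^ d - C b * X) x₀ (m + 1)).discr k) ∧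
      HasOrd 𝔭 (iterSubC (X ^ d - C b * X) x₀ m).discr 0) :
    Nonempty (Gal(preimageField (X ^ d - C b * X) x₀ n/K) ≃* IterSym d n) := by
  classical
  have hd2 : 2 ≤ d := by omega
  have : NeZero d := ⟨by omega⟩
  have hfm := monic_X_pow_sub_C_mul_X hd2 b
  have hfd := natDegree_X_pow_sub_C_mul_X hd2 b
  have hfp : (X ^ d - C b * X).natDegree.Prime := by
    rw [hfd]
    rcases hd with rfl | rfl
    exacts [Nat.prime_two, Nat.prime_three]
  have hsep {k} (hk : k ≤ n) : (iterSubC (X ^ d - C b * X) x₀ k).Separable :=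
    (irreducible_iterSubC_of_le hfp.ne_zero hk hirr).separable
  set L := preimageField (X ^ d - C b * X) x₀ n
  have := isSplittingField_preimageField hirr.ne_zero
  have : IsGalois K L := IsGalois.of_separable_splitting_field (hsep le_rfl)
  have := IsSplittingField.finiteDimensional L (iterSubC (X ^ d - C b * X) x₀ n)
  have : NumberField L := NumberField.of_module_finite K L
  have hs {k} (hk : k ≤ n) :=
    splits_iterSubC_of_le hfm hfp.ne_zero hk hirr (IsSplittingField.splits L _)
  have hrange := range_galPreimageHom_eq (L := L) hfm hfp hirr (hs le_rfl) fun m hm => by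
    obtain ⟨p, hpb, hpx, hpd, hpd', ⟨k, hk, hdisc⟩, hunit⟩ := hram m hm
    exact exists_swap_mem_range_galPreimageHom hd (fun l hl => hsep (hl.trans hm))
      (fun l hl => hs (hl.trans hm)) hpb hpx hpd hpd' hunit hk hdisc
  obtain ⟨e⟩ := nonempty_preimageTreeAut_mulEquiv_iterSym (d := d) (n := n)
    (f := fun y : L => aeval y (X ^ d - C b * X)) fun k hk y hy =>
      (natCard_aeval_fiber_eq (hsep hk) (hs hk) hy).trans hfd
  exact ⟨(MonoidHom.ofInjective galPreimageHom_injective).trans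
    ((MulEquiv.subgroupCongr hrange).trans e)⟩

end NumberField

theorem theorem3p2 (K : Type*) [Field K] [NumberField K] (d : ℕ) (hd : d = 2 ∨ d = 3)
    (b x₀ : K) (s t u w : 𝓞 K) (ht : t ≠ 0) (hw : w ≠ 0)
    (hx₀ : x₀ = (s : K) / (t : K)) (hb : b = (u : K) / (w : K))
    (hst : IsCoprime s t) (huw : IsCoprime u w)
    (f : K[X]) (hf : f = X ^ d - C b * X)
    -- condition (1): `v(b) ≥ 1` (with `v(0) = ∞`) and `v(x₀) = 1` for some prime
    (h1 : ∃ 𝔭₁ : HeightOneSpectrum (𝓞 K),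
      𝔭₁.valuation K b ≤ WithZero.exp (-1 : ℤ) ∧ HasOrd 𝔭₁ x₀ 1)
    -- condition (3), with `m = 1`
    (h3 : ∀ n : ℕ, 1 ≤ n → ∃ 𝔭 : HeightOneSpectrum (𝓞 K),
      s * t * u * w * (d : 𝓞 K) * ((d : 𝓞 K) - 1) ∉ 𝔭.asIdeal ∧
      (∃ k : ℤ, 0 < k ∧ Odd k ∧ HasOrd 𝔭 (iterSubC f x₀ n).discr k) ∧
      ∀ l : ℕ, l < n → HasOrd 𝔭 (iterSubC f x₀ l).discr 0) :
    ∀ n : ℕ, Nonempty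
      ((preimageField f x₀ n ≃ₐ[K] preimageField f x₀ n) ≃* IterSym d n) := by
  subst hf hx₀ hb
  obtain ⟨𝔭₁, hb₁, hx₁⟩ := h1
  refine fun n => theorem3p2_general hd (irreducible_iterSubC (by omega) (hb₁.trans_lt ?_) hx₁ n)
    fun m _ => ?_
  · rw [← WithZero.exp_zero, WithZero.exp_lt_exp]
    exact neg_one_lt_zero
  obtain ⟨𝔭, h𝔭, ⟨k, -, hk, hdisc⟩, hunit⟩ := h3 (m + 1) m.succ_pos
  obtain ⟨hx, hb, hd, hd'⟩ := hasOrd_zero_of_mul_notMem h𝔭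
  exact ⟨𝔭, hb.le, hx, hd, hd', ⟨k, hk, hdisc⟩, hunit m m.lt_succ_self⟩
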